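/- Let $N\ge 2$ be an integer. For $\theta\in(0,\pi/4]$ let $\rho_N^{\theta}=|GHZ_N^{\theta}\rangle\langle GHZ_N^{\theta}|$ be the $N$-qubit pure state with $$|GHZ_N^{\theta}\rangle=\cos\theta\,|0\rangle^{\otimes N}+\sin\theta\,|1\rangle^{\otimes N}.$$ An operation by local operations and shared randomness (LOSR) on $N$ qubits, one held by each of $N$ parties, is a map of the form $$T=\sum_{\lambda}p(\lambda)\,\mathcal E^{(1)}_{\lambda}\otimes\cdots\otimes\mathcal E^{(N)}_{\lambda},$$ where $p$ is the probability distribution of a classical variable $\lambda$ shared by all parties and every $\mathcal E^{(i)}_{\lambda}$ is a completely positive trace-preserving map on the matrices $M_2(\mathbb C)$ of the $i$-th qubit (for a non-discrete distribution of $\lambda$ the sum is replaced by an integral, the product of channels depending measurably on $\lambda$). Then for all $\theta,\phi\in(0,\pi/4]$ with $\theta\neq\phi$ there is no LOSR operation $T$ with $T(\rho_N^{\theta})=\rho_N^{\phi}$. -/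

import Mathlib

open MeasureTheory
open scoped CStarAlgebra MatrixOrder Matrix.Norms.L2Operator

/-- A quantum channel from a system with Hilbert space `ℂⁿ` to one with Hilbert space `ℂᵐ`:
a completely positive trace-preserving linear map between the full matrix algebras. -/
structure QuantumChannel (n m : Type*) [Fintype n] [DecidableEq n] [Fintype m] [DecidableEq m]
    extends Matrix n n ℂ →CP Matrix m m ℂ where
  trace_map' : ∀ X : Matrix n n ℂ, (toFun X).trace = X.trace

/-- The tensor product `⨂ᵢ Eᵢ` of linear maps on matrix algebras, one for each party `i : ι`.
The joint space `(ℂⁿ)^{⊗ι}` has the basis `ι → n`, and the map is given by linear extension of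
`⨂ᵢ |aᵢ⟩⟨bᵢ| ↦ ⨂ᵢ Eᵢ(|aᵢ⟩⟨bᵢ|)`. -/
noncomputable def tensorMap {ι n m : Type*} [Fintype ι] [DecidableEq ι] [Fintype n]
    [DecidableEq n] (E : ι → (Matrix n n ℂ →ₗ[ℂ] Matrix m m ℂ))
    (X : Matrix (ι → n) (ι → n) ℂ) : Matrix (ι → m) (ι → m) ℂ :=
  Matrix.of fun a' b' =>
    ∑ a : ι → n, ∑ b : ι → n,
      X a b * ∏ i, E i (Matrix.single (a i) (b i) 1) (a' i) (b' i)

/-- On product operators, `tensorMap` acts factor by factor. -/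
theorem tensorMap_product {ι n m : Type*} [Fintype ι] [DecidableEq ι] [Fintype n]
    [DecidableEq n] (E : ι → (Matrix n n ℂ →ₗ[ℂ] Matrix m m ℂ)) (X : ι → Matrix n n ℂ) :
    tensorMap E (Matrix.of fun a b => ∏ i, X i (a i) (b i)) =
      Matrix.of fun a' b' => ∏ i, E i (X i) (a' i) (b' i) := by
  ext a' b'
  have h : ∀ i, E i (X i) (a' i) (b' i) =
      ∑ s : n, ∑ t : n, X i s t * E i (Matrix.single s t 1) (a' i) (b' i) := by
    intro i
    conv_lhs => rw [Matrix.matrix_eq_sum_single (X i)]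
    simp only [map_sum, Matrix.sum_apply]
    refine Finset.sum_congr rfl fun s _ => Finset.sum_congr rfl fun t _ => ?_
    have : Matrix.single s t (X i s t) = X i s t • Matrix.single s t (1 : ℂ) := by
      simp [Matrix.smul_single]
    rw [this, map_smul, Matrix.smul_apply, smul_eq_mul]
  simp only [tensorMap, Matrix.of_apply]
  rw [Finset.prod_congr rfl fun i _ => h i, Fintype.prod_sum]
  refine Finset.sum_congr rfl fun a _ => ?_
  rw [Fintype.prod_sum]
  refine Finset.sum_congr rfl fun b _ => ?_
  rw [Finset.prod_mul_distrib]

/-- An LOSR operation on systems shared by the parties `i : ι`: the value `l` of a classical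
random variable (with an arbitrary probability distribution `μ`) is distributed to all parties,
and party `i` applies to its system a local channel `E l i` depending on `l`; the operation is
the average `T = ∫ ⨂ᵢ E l i dμ(l)` (entrywise), for instance a finite or countable mixture
`∑_l p(l) ⨂ᵢ E l i`. The entries of a product of channels are bounded uniformly in `l`, so
the integrability clause only says that the joint operation depends measurably on `l`. -/
def IsLOSROperation {ι n m : Type*} [Fintype ι] [DecidableEq ι] [Fintype n] [DecidableEq n]
    [Fintype m] [DecidableEq m]
    (T : Matrix (ι → n) (ι → n) ℂ → Matrix (ι → m) (ι → m) ℂ) : Prop :=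
  ∃ (Λ : Type) (_ : MeasurableSpace Λ) (μ : Measure Λ) (_ : IsProbabilityMeasure μ)
    (E : Λ → ι → QuantumChannel n m),
    (∀ X a b, Integrable (fun l => tensorMap (fun i => (E l i).toLinearMap) X a b) μ) ∧
    ∀ X a b, T X a b = ∫ l, tensorMap (fun i => (E l i).toLinearMap) X a b ∂μ

/-- `ρ` can be converted into `σ` by an LOSR operation. -/
def LOSRConvertible {ι n m : Type*} [Fintype ι] [DecidableEq ι] [Fintype n] [DecidableEq n]
    [Fintype m] [DecidableEq m]
    (ρ : Matrix (ι → n) (ι → n) ℂ) (σ : Matrix (ι → m) (ι → m) ℂ) : Prop :=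
  ∃ T : Matrix (ι → n) (ι → n) ℂ → Matrix (ι → m) (ι → m) ℂ, IsLOSROperation T ∧ T ρ = σ

/-- The vector `cos θ |0…0⟩ + sin θ |1…1⟩` of `N` qubits, in the computational basis. -/
noncomputable def ghzVector (N : ℕ) (θ : ℝ) : (Fin N → Fin 2) → ℂ :=
  (Real.cos θ : ℂ) • Pi.single (fun _ => 0) 1 + (Real.sin θ : ℂ) • Pi.single (fun _ => 1) 1

/-- The pure state `|GHZ⟩⟨GHZ|` belonging to `ghzVector N θ`. -/
noncomputable def ghzState (N : ℕ) (θ : ℝ) : Matrix (Fin N → Fin 2) (Fin N → Fin 2) ℂ :=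
  Matrix.vecMulVec (ghzVector N θ) (star (ghzVector N θ))

/-! A pure state is extremal, so shared randomness cannot help: the fidelity with the target
averages to 1 over `l`, hence some single product of channels has fidelity at least 1
(`exists_integral_le`). By `exists_eq_mul_of_fidelity`, every choice of Kraus operators then sends
the source vector to a multiple of the target vector. Fixing the choices of all parties but the
first, invertibility of the target's coefficient matrix makes the first party's Kraus operators
proportional (`exists_kraus_proportional`). Its channel is thus a unitary conjugation and preserves
the determinant of the one-qubit marginal (`det_of_kraus_proportional`). That determinant is `(cos θ
sin θ)²`, which determines `θ` on `(0, π/4]`. -/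

/-! ### Kraus operators from complete positivity -/

/-- `CStarAlgebra.nonneg_iff_eq_star_mul_self` stated for a bundled C⋆-algebra structure, so that it
applies to `CStarMatrix`. -/
theorem NonUnitalCStarAlgebra.exists_eq_star_mul_self {A : Type*} [NonUnitalCStarAlgebra A]
    [PartialOrder A] [StarOrderedRing A] {a : A} (ha : 0 ≤ a) : ∃ b, a = star b * b :=
  CStarAlgebra.nonneg_iff_eq_star_mul_self.mp ha

/-- Every quantum channel has a Kraus decomposition, here written on matrix units. -/
theorem QuantumChannel.exists_kraus {n m : Type*} [Fintype n] [DecidableEq n] [Fintype m]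
    [DecidableEq m] (E : QuantumChannel n m) :
    ∃ K : n × m → Matrix m n ℂ, ∀ a b x y,
      E.toLinearMap (Matrix.single a b 1) x y = ∑ k, K k x a * star (K k y b) := by
  classical
  rcases isEmpty_or_nonempty n with hn | ⟨⟨n₀⟩⟩
  · exact ⟨fun _ => 0, fun a => (hn.false a).elim⟩
  -- A square root, up to adjoint, of the Choi block matrix of matrix units; a single nonzero block
  -- row suffices.
  let V : CStarMatrix n n (Matrix n n ℂ) :=
    CStarMatrix.ofMatrix fun k a => if k = n₀ then Matrix.single n₀ a 1 else 0
  have hVe : ∀ k a, V k a = if k = n₀ then Matrix.single n₀ a 1 else 0 := fun _ _ => rfl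
  have hV : star V * V = CStarMatrix.ofMatrix fun a b => Matrix.single a b (1 : ℂ) := by
    ext1 a b
    rw [CStarMatrix.mul_apply, Finset.sum_eq_single n₀]
    · rw [CStarMatrix.star_apply, hVe, hVe, if_pos rfl, if_pos rfl,
        Matrix.star_eq_conjTranspose, Matrix.conjTranspose_single, Matrix.single_mul_single_same,
        star_one, one_mul]
      rfl
    · intro k _ hk
      rw [hVe k b, if_neg hk, mul_zero]
    · simp
  have h := CompletelyPositiveMap.map_cstarMatrix_nonneg E.toCompletelyPositiveMap _
    (hV ▸ star_mul_self_nonneg V)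
  obtain ⟨M, hM⟩ := NonUnitalCStarAlgebra.exists_eq_star_mul_self h
  refine ⟨fun k => Matrix.of fun x a => star (M k.1 a k.2 x), fun a b x y => ?_⟩
  have hab : E.toLinearMap (Matrix.single a b 1) = (star M * M) a b := by
    rw [← hM]; rfl
  rw [hab, CStarMatrix.mul_apply, Matrix.sum_apply, Fintype.sum_prod_type]
  refine Finset.sum_congr rfl fun k _ => ?_
  rw [CStarMatrix.star_apply, Matrix.mul_apply]
  simp [Matrix.star_apply]

theorem QuantumChannel.sum_single_diag {n m : Type*} [Fintype n] [DecidableEq n] [Fintype m]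
    [DecidableEq m] (E : QuantumChannel n m) (a b : n) :
    ∑ x, E.toLinearMap (Matrix.single a b 1) x x = if a = b then 1 else 0 := by
  have h := E.trace_map' (Matrix.single a b 1)
  rw [Matrix.trace, Matrix.trace] at h
  refine h.trans ?_
  change (Matrix.single a b (1 : ℂ)).trace = _
  split_ifs with hab
  · rw [hab, Matrix.trace_single_eq_same]
  · rw [Matrix.trace_single_eq_of_ne _ _ _ hab]

/-! ### Extremality of pure states -/

/-- A mixture of total weight one whose fidelity with a unit vector `χ` is at least one consists of
multiples of `χ`. -/
theorem exists_eq_mul_of_fidelity {F X : Type*} [Fintype F] [Fintype X] (v : F → X → ℂ)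
    (χ : X → ℂ) (hχ : ∑ x, χ x * star (χ x) = 1) (hv : ∑ f, ∑ x, v f x * star (v f x) = 1)
    (h : 1 ≤ (∑ f, (∑ x, star (χ x) * v f x) * star (∑ x, star (χ x) * v f x)).re) :
    ∃ c : F → ℂ, ∀ f x, v f x = c f * χ x := by
  set c : F → ℂ := fun f => ∑ x, star (χ x) * v f x with hc
  refine ⟨c, ?_⟩
  -- Pythagoras: the total squared distance from the line of `χ` is one minus the fidelity, hence at
  -- most zero.
  have key : ∑ f, ∑ x, (v f x - c f * χ x) * star (v f x - c f * χ x) =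
      1 - ∑ f, c f * star (c f) := by
    rw [← hv, ← Finset.sum_sub_distrib]
    refine Finset.sum_congr rfl fun f _ => ?_
    have h1 : ∑ x, v f x * (star (c f) * star (χ x)) = c f * star (c f) := by
      rw [hc, Finset.sum_mul]
      exact Finset.sum_congr rfl fun x _ => by ring
    have h2 : ∑ x, c f * χ x * star (v f x) = c f * star (c f) := by
      conv_rhs => rw [hc]
      simp only [star_sum, Finset.mul_sum, star_mul', star_star]
      exact Finset.sum_congr rfl fun x _ => by ring
    have h3 : ∑ x, c f * χ x * (star (c f) * star (χ x)) = c f * star (c f) := by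
      rw [← mul_one (c f * star (c f)), ← hχ, Finset.mul_sum]
      exact Finset.sum_congr rfl fun x _ => by ring
    simp only [star_sub, star_mul', sub_mul, mul_sub, Finset.sum_sub_distrib, h1, h2, h3]
    ring
  have hn : ∀ z : ℂ, z * star z = ((‖z‖ ^ 2 : ℝ) : ℂ) := fun z => by
    rw [Complex.star_def, Complex.mul_conj, Complex.normSq_eq_norm_sq]
  have hre : ∑ f, ∑ x, ‖v f x - c f * χ x‖ ^ 2 ≤ 0 := by
    have := congrArg Complex.re key
    simp only [hn (_ - _), ← Complex.ofReal_sum, Complex.ofReal_re, Complex.sub_re,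
      Complex.one_re] at this
    linarith
  intro f x
  have hle : ‖v f x - c f * χ x‖ ^ 2 ≤ 0 :=
    ((Finset.single_le_sum (f := fun x => ‖v f x - c f * χ x‖ ^ 2)
      (fun _ _ => sq_nonneg _) (Finset.mem_univ x)).trans
      (Finset.single_le_sum (f := fun f => ∑ x, ‖v f x - c f * χ x‖ ^ 2)
        (fun _ _ => Finset.sum_nonneg fun _ _ => sq_nonneg _) (Finset.mem_univ f))).trans hre
  exact sub_eq_zero.mp (norm_eq_zero.mp (pow_eq_zero_iff two_ne_zero |>.mp
    (le_antisymm hle (sq_nonneg _))))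

/-! ### GHZ states and their one-party marginals -/

/-- The nonzero amplitudes of `ghzVector N θ`. -/
noncomputable def ghzAmplitude (θ : ℝ) : Fin 2 → ℂ := ![(Real.cos θ : ℂ), (Real.sin θ : ℂ)]

theorem star_ghzAmplitude (θ : ℝ) (s : Fin 2) : star (ghzAmplitude θ s) = ghzAmplitude θ s := by
  fin_cases s <;> simp [ghzAmplitude, -Complex.ofReal_cos, -Complex.ofReal_sin]

theorem sum_ghzAmplitude_sq (θ : ℝ) : ∑ s, ghzAmplitude θ s ^ 2 = 1 := by
  simp [ghzAmplitude]

theorem ghzVector_apply (N : ℕ) (θ : ℝ) (x : Fin N → Fin 2) :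
    ghzVector N θ x = ∑ s, ghzAmplitude θ s * if x = (fun _ => s) then 1 else 0 := by
  simp [ghzVector, ghzAmplitude, Pi.single_apply]

theorem ghzState_apply (N : ℕ) (θ : ℝ) (x y : Fin N → Fin 2) :
    ghzState N θ x y = ∑ s, ∑ t, ghzAmplitude θ s * ghzAmplitude θ t *
      ((if x = (fun _ => s) then 1 else 0) * if y = (fun _ => t) then 1 else 0) := by
  rw [ghzState, Matrix.vecMulVec_apply, Pi.star_apply, ghzVector_apply, ghzVector_apply, star_sum,
    Finset.sum_mul_sum]
  refine Finset.sum_congr rfl fun s _ => Finset.sum_congr rfl fun t _ => ?_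
  rw [star_mul', star_ghzAmplitude]
  split_ifs <;> simp

theorem tensorMap_ghzState {m : Type*} (N : ℕ) (θ : ℝ)
    (E : Fin N → (Matrix (Fin 2) (Fin 2) ℂ →ₗ[ℂ] Matrix m m ℂ)) (x y : Fin N → m) :
    tensorMap E (ghzState N θ) x y = ∑ s, ∑ t, ghzAmplitude θ s * ghzAmplitude θ t *
      ∏ i, E i (Matrix.single s t 1) (x i) (y i) := by
  simp only [tensorMap, Matrix.of_apply, ghzState_apply, Finset.sum_mul]
  simp only [Fin.sum_univ_two, Finset.sum_add_distrib]
  simp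

/-- A sum over `n + 1` coordinates as an iterated sum. -/
theorem Fintype.sum_pi_fin_succ {α M : Type*} [Fintype α] [AddCommMonoid M] (n : ℕ)
    (g : (Fin (n + 1) → α) → M) :
    ∑ x, g x = ∑ x : α, ∑ z : Fin n → α, g (Fin.cons x z) := by
  rw [← (Fin.consEquiv fun _ => α).sum_comp, Fintype.sum_prod_type]
  rfl

/-- The partial trace over all parties but the first; since at least one party is traced out, the
coherences vanish. -/
theorem sum_ghzState_cons (n : ℕ) (φ : ℝ) (x y : Fin 2) :
    ∑ z : Fin (n + 1) → Fin 2, ghzState (n + 2) φ (Fin.cons x z) (Fin.cons y z) =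
      Matrix.diagonal (fun s => ghzAmplitude φ s ^ 2) x y := by
  have hc : ∀ (x s : Fin 2) (z : Fin (n + 1) → Fin 2),
      (Fin.cons x z : Fin (n + 2) → Fin 2) = (fun _ => s) ↔ x = s ∧ z = fun _ => s := by
    intro x s z
    constructor
    · intro h
      exact ⟨by simpa using congrFun h 0, funext fun i => by simpa using congrFun h i.succ⟩
    · rintro ⟨rfl, rfl⟩
      funext i
      refine Fin.cases ?_ (fun j => ?_) i <;> simp
  have hconst : ∀ s t : Fin 2,
      (fun _ : Fin (n + 1) => s) = (fun _ => t) ↔ s = t :=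
    fun s t => ⟨fun h => congrFun h 0, fun h => h ▸ rfl⟩
  simp only [ghzState_apply, hc, Fin.sum_univ_two, Finset.sum_add_distrib, ← Finset.mul_sum]
  fin_cases x <;> fin_cases y <;>
    simp [hconst, sq]

theorem sum_ghzVector_mul_star (n : ℕ) (φ : ℝ) :
    ∑ x, ghzVector (n + 2) φ x * star (ghzVector (n + 2) φ x) = 1 := by
  rw [Fintype.sum_pi_fin_succ]
  calc _ = ∑ x, Matrix.diagonal (fun s => ghzAmplitude φ s ^ 2) x x :=
        Finset.sum_congr rfl fun x _ => sum_ghzState_cons n φ x x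
    _ = 1 := by simpa using sum_ghzAmplitude_sq φ

/-- The other channels preserve traces, so the first marginal of the output depends only on the
first channel and the first marginal of the input. -/
theorem sum_tensorMap_ghzState_cons {m : Type*} [Fintype m] [DecidableEq m] (n : ℕ) (θ : ℝ)
    (E : Fin (n + 2) → QuantumChannel (Fin 2) m) (x y : m) :
    ∑ z : Fin (n + 1) → m, tensorMap (fun i => (E i).toLinearMap) (ghzState (n + 2) θ)
        (Fin.cons x z) (Fin.cons y z) =
      ∑ s, ghzAmplitude θ s ^ 2 * (E 0).toLinearMap (Matrix.single s s 1) x y := by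
  have hp : ∀ s t : Fin 2, ∑ z : Fin (n + 1) → m,
      ∏ i, (E (Fin.succ i)).toLinearMap (Matrix.single s t 1) (z i) (z i) =
        if s = t then 1 else 0 := by
    intro s t
    rw [← Fintype.prod_sum fun (i : Fin (n + 1)) (w : m) =>
      (E (Fin.succ i)).toLinearMap (Matrix.single s t 1) w w]
    simp only [QuantumChannel.sum_single_diag]
    split_ifs <;> simp
  simp only [tensorMap_ghzState, Fin.prod_univ_succ (n := n + 1), Fin.cons_zero, Fin.cons_succ]
  rw [Finset.sum_comm]
  refine Finset.sum_congr rfl fun s _ => ?_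
  rw [Finset.sum_comm]
  simp only [← Finset.mul_sum, hp]
  simp [sq]

theorem sum_tensorMap_ghzState_diag {m : Type*} [Fintype m] [DecidableEq m] (n : ℕ) (θ : ℝ)
    (E : Fin (n + 2) → QuantumChannel (Fin 2) m) :
    ∑ x, tensorMap (fun i => (E i).toLinearMap) (ghzState (n + 2) θ) x x = 1 := by
  rw [Fintype.sum_pi_fin_succ]
  simp only [sum_tensorMap_ghzState_cons]
  rw [Finset.sum_comm]
  simp only [← Finset.mul_sum, QuantumChannel.sum_single_diag]
  simpa using sum_ghzAmplitude_sq θ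

/-- The components of the output of a product of channels given by Kraus operators. -/
theorem tensorMap_ghzState_kraus {m κ : Type*} [Fintype κ] (N : ℕ) (θ : ℝ)
    (E : Fin N → (Matrix (Fin 2) (Fin 2) ℂ →ₗ[ℂ] Matrix m m ℂ))
    (K : Fin N → κ → Matrix m (Fin 2) ℂ)
    (hK : ∀ i a b x y, E i (Matrix.single a b 1) x y = ∑ k, K i k x a * star (K i k y b))
    (x y : Fin N → m) :
    tensorMap E (ghzState N θ) x y = ∑ f : Fin N → κ,
      (∑ s, ghzAmplitude θ s * ∏ i, K i (f i) (x i) s) *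
        star (∑ s, ghzAmplitude θ s * ∏ i, K i (f i) (y i) s) := by
  simp only [tensorMap_ghzState, hK, star_sum, Finset.sum_mul_sum]
  rw [Finset.sum_comm' (t' := Finset.univ) (s' := fun _ => Finset.univ) (by simp)]
  rw [Finset.sum_comm]
  conv_rhs => rw [Finset.sum_comm]
  refine Finset.sum_congr rfl fun s _ => ?_
  conv_rhs => rw [Finset.sum_comm]
  refine Finset.sum_congr rfl fun t _ => ?_
  rw [Fintype.prod_sum, Finset.mul_sum]
  refine Finset.sum_congr rfl fun f _ => ?_
  rw [star_mul', star_ghzAmplitude, star_prod, Finset.prod_mul_distrib]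
  ring

/-! ### Rigidity of the local channels -/

/-- If a product of channels sends a GHZ vector to multiples of an entangled GHZ vector, the Kraus
operators of each party are proportional to each other; here for the first party. -/
theorem exists_kraus_proportional {κ : Type*} (n : ℕ) (θ φ : ℝ)
    (hφ : φ ∈ Set.Ioc 0 (Real.pi / 4)) (K : Fin (n + 2) → κ → Matrix (Fin 2) (Fin 2) ℂ)
    (c : (Fin (n + 2) → κ) → ℂ)
    (hc : ∀ f x, ∑ s, ghzAmplitude θ s * ∏ i, K i (f i) (x i) s = c f * ghzVector (n + 2) φ x)
    (f₀ : Fin (n + 2) → κ) (hf₀ : c f₀ ≠ 0) :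
    ∃ (U : Matrix (Fin 2) (Fin 2) ℂ) (d : κ → ℂ), ∀ k, K 0 k = d k • U := by
  -- Only outputs on which all other parties share one value `z` are kept: `G` is the target vector,
  -- and `M` the source after the others' Kraus operators, so reshaped.
  let G : Matrix (Fin 2) (Fin 2) ℂ := Matrix.diagonal (ghzAmplitude φ)
  let M : Matrix (Fin 2) (Fin 2) ℂ := Matrix.of fun s z =>
    ghzAmplitude θ s * ∏ i : Fin (n + 1), K i.succ (f₀ i.succ) z s
  have hKM : ∀ k, K 0 k * M = c (Fin.cons k (Fin.tail f₀)) • G := by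
    intro k
    ext x z
    have h := hc (Fin.cons k (Fin.tail f₀)) (Fin.cons x fun _ => z)
    simp only [Fin.prod_univ_succ (n := n + 1), Fin.cons_zero, Fin.cons_succ] at h
    have hg : ghzVector (n + 2) φ (Fin.cons x fun _ => z) = G x z := by
      have hx : ∀ s : Fin 2, (Fin.cons x (fun _ => z) : Fin (n + 2) → Fin 2) = (fun _ => s) ↔
          x = s ∧ z = s := by
        intro s
        constructor
        · intro h
          exact ⟨by simpa using congrFun h 0, by simpa using congrFun h (Fin.succ 0)⟩
        · rintro ⟨rfl, rfl⟩
          funext i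
          refine Fin.cases ?_ (fun j => ?_) i <;> simp
      simp only [ghzVector_apply, hx, G]
      fin_cases x <;> fin_cases z <;> simp
    rw [hg] at h
    rw [Matrix.mul_apply, Matrix.smul_apply, smul_eq_mul, ← h]
    refine Finset.sum_congr rfl fun s _ => ?_
    simp only [M, Matrix.of_apply, Fin.tail]
    ring
  have hGdet : G.det ≠ 0 := by
    have hpi := Real.pi_pos
    have h1 : Real.cos φ ≠ 0 :=
      (Real.cos_pos_of_mem_Ioo ⟨by linarith [hφ.1], by linarith [hφ.2]⟩).ne'
    have h2 : Real.sin φ ≠ 0 :=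
      (Real.sin_pos_of_pos_of_lt_pi hφ.1 (by linarith [hφ.2])).ne'
    simp only [G, Matrix.det_diagonal, Fin.prod_univ_two, ghzAmplitude]
    simpa [-Complex.ofReal_cos, -Complex.ofReal_sin] using And.intro h1 h2
  have hM : IsUnit M.det := by
    -- With `k = f₀ 0` the full choice is `f₀` itself, whose coefficient is nonzero.
    have h := congrArg Matrix.det (hKM (f₀ 0))
    rw [Fin.cons_self_tail, Matrix.det_mul, Matrix.det_smul] at h
    refine isUnit_iff_ne_zero.mpr fun h0 => ?_
    rw [h0, mul_zero] at h
    exact mul_ne_zero (pow_ne_zero _ hf₀) hGdet h.symm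
  refine ⟨G * M⁻¹, fun k => c (Fin.cons k (Fin.tail f₀)), fun k => ?_⟩
  rw [← Matrix.smul_mul, ← hKM k, Matrix.mul_nonsing_inv_cancel_right _ _ hM]

/-- A channel all of whose Kraus operators are proportional preserves determinants. -/
theorem det_of_kraus_proportional {n κ : Type*} [Fintype n] [DecidableEq n] [Fintype κ]
    (E : QuantumChannel n n) (K : κ → Matrix n n ℂ)
    (hK : ∀ a b x y, E.toLinearMap (Matrix.single a b 1) x y = ∑ k, K k x a * star (K k y b))
    (U : Matrix n n ℂ) (d : κ → ℂ) (hU : ∀ k, K k = d k • U) (p : n → ℂ) :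
    (Matrix.of fun x y => ∑ s, p s * E.toLinearMap (Matrix.single s s 1) x y).det =
      ∏ s, p s := by
  set D : ℂ := ∑ k, d k * star (d k)
  have hE : ∀ a b x y, E.toLinearMap (Matrix.single a b 1) x y = D * (U x a * star (U y b)) := by
    intro a b x y
    rw [hK, Finset.sum_mul]
    refine Finset.sum_congr rfl fun k _ => ?_
    rw [hU, Matrix.smul_apply, Matrix.smul_apply, smul_eq_mul, smul_eq_mul, star_mul']
    ring
  -- Trace preservation: `U` is unitary up to the scale `D`.
  have h1 : (D • U.conjTranspose) * U = 1 := by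
    ext b a
    have h := E.sum_single_diag a b
    simp only [hE] at h
    rw [Matrix.one_apply, Matrix.mul_apply]
    simp only [eq_comm (a := b)]
    rw [← h]
    refine Finset.sum_congr rfl fun x _ => ?_
    simp only [Matrix.smul_apply, Matrix.conjTranspose_apply, smul_eq_mul]
    ring
  have h2 : (Matrix.of fun x y => ∑ s, p s * E.toLinearMap (Matrix.single s s 1) x y) =
      U * Matrix.diagonal p * (D • U.conjTranspose) := by
    ext x y
    simp only [Matrix.of_apply, hE]
    rw [Matrix.mul_apply]
    refine Finset.sum_congr rfl fun s _ => ?_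
    simp only [Matrix.mul_diagonal, Matrix.smul_apply, Matrix.conjTranspose_apply, smul_eq_mul]
    ring
  have h3 := congrArg Matrix.det h1
  rw [Matrix.det_mul, Matrix.det_one] at h3
  rw [h2, Matrix.det_mul, Matrix.det_mul, Matrix.det_diagonal]
  linear_combination (∏ s, p s) * h3

/-- If some product of channels maps one GHZ state to a state with fidelity at least one with
another, the two states have the same parameter. -/
theorem ghz_parameter_eq (n : ℕ) (θ φ : ℝ) (hθ : θ ∈ Set.Ioc 0 (Real.pi / 4))
    (hφ : φ ∈ Set.Ioc 0 (Real.pi / 4)) (E : Fin (n + 2) → QuantumChannel (Fin 2) (Fin 2))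
    (h : 1 ≤ (∑ x, ∑ y, star (ghzVector (n + 2) φ x) * ghzVector (n + 2) φ y *
      tensorMap (fun i => (E i).toLinearMap) (ghzState (n + 2) θ) x y).re) : θ = φ := by
  choose K hK using fun i => (E i).exists_kraus
  set v : (Fin (n + 2) → Fin 2 × Fin 2) → (Fin (n + 2) → Fin 2) → ℂ := fun f x =>
    ∑ s, ghzAmplitude θ s * ∏ i, K i (f i) (x i) s
  have hT : ∀ x y, tensorMap (fun i => (E i).toLinearMap) (ghzState (n + 2) θ) x y =
      ∑ f, v f x * star (v f y) := tensorMap_ghzState_kraus _ θ _ K hK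
  have hv1 : ∑ f, ∑ x, v f x * star (v f x) = 1 := by
    rw [Finset.sum_comm, ← sum_tensorMap_ghzState_diag n θ E]
    exact Finset.sum_congr rfl fun x _ => (hT x x).symm
  have hχ := sum_ghzVector_mul_star n φ
  obtain ⟨c, hc⟩ := exists_eq_mul_of_fidelity v (ghzVector (n + 2) φ) hχ hv1 (by
    refine h.trans_eq (congrArg Complex.re ?_)
    simp only [hT, star_sum, Finset.sum_mul_sum]
    simp only [Finset.mul_sum]
    conv_rhs => rw [Finset.sum_comm]
    refine Finset.sum_congr rfl fun x _ => ?_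
    conv_rhs => rw [Finset.sum_comm]
    refine Finset.sum_congr rfl fun y _ => Finset.sum_congr rfl fun f _ => ?_
    rw [star_mul', star_star]
    ring)
  have hcc : ∀ f x y, v f x * star (v f y) = c f * star (c f) * ghzState (n + 2) φ x y := by
    intro f x y
    rw [hc, hc, star_mul', ghzState, Matrix.vecMulVec_apply, Pi.star_apply]
    ring
  have hC : ∑ f, c f * star (c f) = 1 := by
    rw [← hv1]
    refine Finset.sum_congr rfl fun f _ => ?_
    simp only [hcc, ← Finset.mul_sum]
    exact (mul_one _).symm.trans (congrArg _ hχ.symm)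
  obtain ⟨f₀, hf₀⟩ : ∃ f, c f ≠ 0 := by
    by_contra! h0
    simp [h0] at hC
  obtain ⟨U, d, hU⟩ := exists_kraus_proportional n θ φ hφ K c hc f₀ hf₀
  have hdet := det_of_kraus_proportional (E 0) (K 0) (hK 0) U d hU
    fun s => ghzAmplitude θ s ^ 2
  have hR : (Matrix.of fun x y => ∑ s, ghzAmplitude θ s ^ 2 *
      (E 0).toLinearMap (Matrix.single s s 1) x y) =
        Matrix.diagonal fun s => ghzAmplitude φ s ^ 2 := by
    ext x y
    rw [Matrix.of_apply, ← sum_tensorMap_ghzState_cons, ← sum_ghzState_cons n]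
    refine Finset.sum_congr rfl fun z _ => ?_
    simp only [hT, hcc, ← Finset.sum_mul, hC, one_mul]
  rw [hR, Matrix.det_diagonal, Fin.prod_univ_two, Fin.prod_univ_two] at hdet
  have hcs : (Real.cos φ * Real.sin φ) ^ 2 = (Real.cos θ * Real.sin θ) ^ 2 := by
    simp only [ghzAmplitude, Matrix.cons_val_zero, Matrix.cons_val_one] at hdet
    rw [mul_pow, mul_pow]
    exact_mod_cast hdet
  have hpi := Real.pi_pos
  have hpos : ∀ t ∈ Set.Ioc 0 (Real.pi / 4), 0 ≤ Real.cos t * Real.sin t := fun t ht =>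
    mul_nonneg (Real.cos_nonneg_of_mem_Icc ⟨by linarith [ht.1], by linarith [ht.2]⟩)
      (Real.sin_nonneg_of_nonneg_of_le_pi ht.1.le (by linarith [ht.2]))
  have hcs' := (pow_left_inj₀ (hpos φ hφ) (hpos θ hθ) two_ne_zero).mp hcs
  have hsin : Real.sin (2 * θ) = Real.sin (2 * φ) := by
    rw [Real.sin_two_mul, Real.sin_two_mul]
    linarith
  -- Both `2θ` and `2φ` lie in `(0, π/2]`, where sine is injective.
  have := Real.injOn_sin ⟨by linarith [hθ.1], by linarith [hθ.2]⟩
    ⟨by linarith [hφ.1], by linarith [hφ.2]⟩ hsin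
  linarith

theorem mainTheorem6 (N : ℕ) (hN : 2 ≤ N) (θ φ : ℝ)
    (hθ : θ ∈ Set.Ioc 0 (Real.pi / 4)) (hφ : φ ∈ Set.Ioc 0 (Real.pi / 4)) (hne : θ ≠ φ) :
    ¬ LOSRConvertible (ghzState N θ) (ghzState N φ) := by
  obtain ⟨n, rfl⟩ := Nat.exists_eq_add_of_le' hN
  rintro ⟨T, ⟨Λ, _, μ, _, E, hint, hT⟩, hTρ⟩
  let χ := ghzVector (n + 2) φ
  let F : Λ → ℂ := fun l => ∑ x, ∑ y, star (χ x) * χ y *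
    tensorMap (fun i => (E l i).toLinearMap) (ghzState (n + 2) θ) x y
  have hterm : ∀ x y, Integrable (fun l => star (χ x) * χ y *
      tensorMap (fun i => (E l i).toLinearMap) (ghzState (n + 2) θ) x y) μ :=
    fun x y => (hint _ x y).const_mul _
  have hFint : Integrable F μ :=
    integrable_finsetSum _ fun x _ => integrable_finsetSum _ fun y _ => hterm x y
  have hF : ∫ l, F l ∂μ = 1 := by
    calc ∫ l, F l ∂μ = ∑ x, ∑ y, star (χ x) * χ y * ghzState (n + 2) φ x y := by
          rw [integral_finsetSum _ fun x _ => integrable_finsetSum _ fun y _ => hterm x y]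
          refine Finset.sum_congr rfl fun x _ => ?_
          rw [integral_finsetSum _ fun y _ => hterm x y]
          refine Finset.sum_congr rfl fun y _ => ?_
          rw [integral_const_mul, ← hT, hTρ]
      _ = (∑ x, χ x * star (χ x)) * ∑ y, χ y * star (χ y) := by
          rw [Finset.sum_mul_sum]
          refine Finset.sum_congr rfl fun x _ => Finset.sum_congr rfl fun y _ => ?_
          rw [ghzState, Matrix.vecMulVec_apply, Pi.star_apply]
          ring
      _ = 1 := by rw [sum_ghzVector_mul_star, one_mul]
  -- A real function is somewhere at least its mean; one such `l` suffices.
  obtain ⟨l, hl⟩ := exists_integral_le hFint.re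
  refine hne (ghz_parameter_eq n θ φ hθ hφ (E l) (le_trans ?_ hl))
  have hre := integral_re hFint
  rw [hF] at hre
  exact hre.symm ▸ (by simp)
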